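/- An unweighted instance of Multiple Allocation $k$-Hub Center (MA$k$HC) consists of a finite connected graph $G$, sets $\mathcal C$ (clients) and $\mathcal H$ (hub locations) with $V(G)=\mathcal C\cup\mathcal H$, a set of demands $\mathcal D\subseteq\mathcal C^2$ and a positive integer $k$. Let $d(u,v)$ be the number of edges of a shortest path between $u$ and $v$ in $G$. For a non-negative number $r$, the instance $(G,\mathcal C,\mathcal H,\mathcal D,k,r)$ is positive if there is a set $S\subseteq\mathcal H$ of size $k$ such that for every $(a,b)\in\mathcal D$ some $h\in S$ satisfies $d(a,h)+d(h,b)\le r$. It is preprocessed if every vertex $v\in V(G)$ satisfies $\min_{(a,b)\in\mathcal D}\bigl(d(a,v)+d(v,b)\bigr)\le r$. **Lemma.** Let $(G,\mathcal C,\mathcal H,\mathcal D,k,r)$ be a positive, preprocessed instance of MA$k$HC such that $G$ is an unweighted planar graph. If $G$ has a $(\rho\times\rho)$-grid as a minor, then $$\rho\le\sqrt{k}\,(2r+1)+2r.$$ -/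

import Mathlib

namespace HubCenter

/-- An embedding of a simple graph in the plane: distinct vertices are distinct points, every edge
is a simple curve (an injective continuous image of `[0,1]`) joining its two ends, the interior of
an edge contains no vertex, and two distinct edges meet at most in common ends. -/
structure PlaneEmbedding {V : Type*} (G : SimpleGraph V) where
  point : V → ℝ × ℝ
  point_injective : Function.Injective point
  curve : G.edgeSet → unitInterval → ℝ × ℝ
  curve_continuous : ∀ e, Continuous (curve e)
  curve_injective : ∀ e, Function.Injective (curve e)
  curve_ends : ∀ e : G.edgeSet, s(curve e 0, curve e 1) = Sym2.map point (e : Sym2 V)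
  curve_avoids_vertices : ∀ e t v, curve e t = point v → t = 0 ∨ t = 1
  curves_disjoint : ∀ e f, e ≠ f → ∀ s t, curve e s = curve f t →
    (s = 0 ∨ s = 1) ∧ (t = 0 ∨ t = 1)

/-- A graph is planar if it has an embedding in the plane. -/
def IsPlanar {V : Type*} (G : SimpleGraph V) : Prop :=
  Nonempty (PlaneEmbedding G)

/-- `F` is a minor of `G`: there are pairwise disjoint, nonempty, connected branch sets in `G`, one
for every vertex of `F`, with an edge of `G` between the branch sets of any two adjacent vertices
of `F`. (`SimpleGraph.Connected` includes non-emptiness.) -/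
def IsMinor {W V : Type*} (F : SimpleGraph W) (G : SimpleGraph V) : Prop :=
  ∃ B : W → Set V,
    (∀ w, (G.induce (B w)).Connected) ∧
    (∀ w w', w ≠ w' → Disjoint (B w) (B w')) ∧
    (∀ w w', F.Adj w w' → ∃ u ∈ B w, ∃ v ∈ B w', G.Adj u v)

/-- The `(ρ × ρ)`-grid: `(x, y)` and `(x', y')` are adjacent iff `|x - x'| + |y - y'| = 1`. -/
def grid (ρ : ℕ) : SimpleGraph (Fin ρ × Fin ρ) where
  Adj p q := |((p.1 : ℕ) : ℤ) - ((q.1 : ℕ) : ℤ)| + |((p.2 : ℕ) : ℤ) - ((q.2 : ℕ) : ℤ)| = 1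
  symm := ⟨fun p q h => by
    rw [abs_sub_comm ((q.1 : ℕ) : ℤ), abs_sub_comm ((q.2 : ℕ) : ℤ)]; exact h⟩
  loopless := ⟨fun p h => by simp at h⟩

/-- An unweighted instance of Multiple Allocation `k`-Hub Center: a connected graph, a set of
clients and a set of hub locations that together cover the vertices, a set of demands (ordered
pairs of clients) and a positive integer `k`. -/
structure Instance (V : Type*) where
  graph : SimpleGraph V
  connected : graph.Connected
  clients : Set V
  locations : Set V
  clients_union_locations : clients ∪ locations = Set.univ
  demands : Set (V × V)
  demands_subset : demands ⊆ clients ×ˢ clients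
  k : ℕ
  k_pos : 0 < k

/-- The length `d(a, v) + d(v, b)` of a shortest walk that serves the demand `p = (a, b)` and goes
through `v`; here `d` counts edges, as the graph is unweighted (and connected). -/
noncomputable def Instance.serviceCost {V : Type*} (I : Instance V) (p : V × V) (v : V) : ℕ :=
  I.graph.dist p.1 v + I.graph.dist v p.2

/-- `S` is a solution of value at most `r`: a set of exactly `k` hub locations such that
`max_{(a,b) ∈ D} min_{h ∈ S} (d(a,h) + d(h,b)) ≤ r`. -/
def Instance.IsSolution {V : Type*} (I : Instance V) (r : ℝ) (S : Finset V) : Prop :=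
  (∀ h ∈ S, h ∈ I.locations) ∧ S.card = I.k ∧
    ∀ p ∈ I.demands, ∃ h ∈ S, (I.serviceCost p h : ℝ) ≤ r

/-- The instance, with the bound `r`, is positive (a yes-instance of the decision problem). -/
def Instance.IsPositive {V : Type*} (I : Instance V) (r : ℝ) : Prop :=
  ∃ S : Finset V, I.IsSolution r S

/-- The instance is preprocessed with respect to `r`: every vertex `v` satisfies
`min_{(a,b) ∈ D} (d(a,v) + d(v,b)) ≤ r`. -/
def Instance.IsPreprocessed {V : Type*} (I : Instance V) (r : ℝ) : Prop :=
  ∀ v : V, ∃ p ∈ I.demands, (I.serviceCost p v : ℝ) ≤ r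

end HubCenter

/-! A demand `(a, b)` cheap at `v` is served by a hub `h`. The walks from `v` to `h` through `a` and
through `b` have total length at most `2r`, so every vertex is within `r` of a hub. Distances are
integers, so `k` balls of radius `R = ⌊r⌋` cover the graph.

Extend the branch sets of the grid minor until they cover all vertices, and contract them. This
gives a supergraph of the grid which, being a minor of a planar graph, has no `K₅` minor. An edge
from an interior grid point to a point outside the surrounding 3 × 3 square would create one
(`near_of_adj`). So a step of `G` at an interior branch set changes each grid coordinate by at most
1, and walks between points deep enough in the grid inherit this (`near_of_walk`). A ball of radius
`R` therefore meets at most `(2R + 1)²` branch sets at depth `R`. There are `(ρ - 2R)²` of these, so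
`(ρ - 2R)² ≤ k (2R + 1)²`; take square roots.

That planar graphs have no `K₅` minor is proved without the Jordan curve theorem. Edges of a drawing
of `K₅` are replaced by polygonal chains, and the parity of crossings of two chains is written
through vertical rays below their vertices. If all pairs of edges without a common end were
disjoint, these parities would add up to `1 = 0` in `ZMod 2`. -/

/-! ### Crossing parity of segments and polygonal chains -/

/-- The height at abscissa `x` of the (non-vertical) line through `c` and `d`. -/
noncomputable def lineHeight (c d : ℝ × ℝ) (x : ℝ) : ℝ :=
  c.2 + (d.2 - c.2) / (d.1 - c.1) * (x - c.1)

/-- The parity of the number of points in which the open vertical ray below `p` meets the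
segment from `c` to `d`. -/
noncomputable def rayParity (p c d : ℝ × ℝ) : ZMod 2 :=
  open Classical in
  if min c.1 d.1 < p.1 ∧ p.1 < max c.1 d.1 ∧ lineHeight c d p.1 < p.2 then 1 else 0

/-- The indicator of `p` being strictly to the left of `q`. -/
noncomputable def leftParity (p q : ℝ × ℝ) : ZMod 2 :=
  open Classical in if p.1 < q.1 then 1 else 0

theorem lineHeight_comm (c d : ℝ × ℝ) (x : ℝ) (h : c.1 ≠ d.1) :
    lineHeight c d x = lineHeight d c x := by
  have h1 : d.1 - c.1 ≠ 0 := sub_ne_zero.2 h.symm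
  have h2 : c.1 - d.1 ≠ 0 := sub_ne_zero.2 h
  unfold lineHeight
  field_simp
  have : c.1 - d.1 = -(d.1 - c.1) := by ring
  rw [this]
  field_simp
  ring

theorem rayParity_comm (p c d : ℝ × ℝ) : rayParity p c d = rayParity p d c := by
  unfold rayParity
  rw [min_comm, max_comm]
  by_cases h : c.1 = d.1
  · have h' : ∀ q, ¬ (d.1 < p.1 ∧ p.1 < d.1 ∧ q) := fun q hq => lt_asymm hq.1 hq.2.1
    simp only [h, min_self, max_self, h', if_false]
  · rw [lineHeight_comm c d _ h]

theorem leftParity_add_swap {p q : ℝ × ℝ} (h : p.1 ≠ q.1) :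
    leftParity p q + leftParity q p = 1 := by
  unfold leftParity
  rcases lt_or_gt_of_ne h with h | h
  · simp [h, h.not_gt]
  · simp [h, h.not_gt]

theorem mem_segment_lineHeight {a b : ℝ × ℝ} {x : ℝ} (hab : a.1 < b.1) (hax : a.1 ≤ x)
    (hxb : x ≤ b.1) : (x, lineHeight a b x) ∈ segment ℝ a b := by
  have h : 0 < b.1 - a.1 := sub_pos.2 hab
  rw [segment_eq_image']
  refine ⟨(x - a.1) / (b.1 - a.1), ⟨div_nonneg (by linarith) h.le, (div_le_one h).2 (by linarith)⟩, ?_⟩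
  ext
  · simp; field_simp; ring
  · simp [lineHeight]; field_simp

/-- The intermediate value theorem for the difference of heights, between two abscissae common to
both segments. -/
theorem not_disjoint_segment_of_lineHeight {a b c d : ℝ × ℝ} {x y : ℝ} (hab : a.1 < b.1)
    (hcd : c.1 < d.1) (hx : x ∈ Set.Icc a.1 b.1 ∩ Set.Icc c.1 d.1)
    (hy : y ∈ Set.Icc a.1 b.1 ∩ Set.Icc c.1 d.1) (h1 : lineHeight a b x ≤ lineHeight c d x)
    (h2 : lineHeight c d y ≤ lineHeight a b y) :
    ¬ Disjoint (segment ℝ a b) (segment ℝ c d) := by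
  have hcont : Continuous fun x => lineHeight a b x - lineHeight c d x := by
    unfold lineHeight; fun_prop
  have h0 : (0 : ℝ) ∈ Set.uIcc (lineHeight a b x - lineHeight c d x)
      (lineHeight a b y - lineHeight c d y) :=
    Set.mem_uIcc.2 (Or.inl ⟨by linarith, by linarith⟩)
  obtain ⟨z, hz, hz0⟩ := intermediate_value_uIcc hcont.continuousOn h0
  have hz1 := Set.uIcc_subset_Icc hx.1 hy.1 hz
  have hz2 := Set.uIcc_subset_Icc hx.2 hy.2 hz
  have heq : lineHeight a b z = lineHeight c d z := sub_eq_zero.1 hz0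
  rw [Set.not_disjoint_iff]
  refine ⟨_, mem_segment_lineHeight hab hz1.1 hz1.2, ?_⟩
  rw [heq]
  exact mem_segment_lineHeight hcd hz2.1 hz2.2

theorem lineHeight_left (a b : ℝ × ℝ) : lineHeight a b a.1 = a.2 := by simp [lineHeight]

theorem lineHeight_right {a b : ℝ × ℝ} (h : a.1 < b.1) : lineHeight a b b.1 = b.2 := by
  have h : b.1 - a.1 ≠ 0 := (sub_pos.2 h).ne'
  simp [lineHeight, h]

/-- The parity of the number of crossings of the segments `ab` and `cd`, in terms of their ends. -/
noncomputable def crossParity (a b c d : ℝ × ℝ) : ZMod 2 :=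
  rayParity a c d + rayParity b c d + rayParity c a b + rayParity d a b +
    (leftParity a c + leftParity b c + leftParity a d + leftParity b d)

theorem crossParity_swap_left (a b c d : ℝ × ℝ) : crossParity a b c d = crossParity b a c d := by
  unfold crossParity
  rw [rayParity_comm c a b, rayParity_comm d a b]
  ring

theorem crossParity_swap_right (a b c d : ℝ × ℝ) : crossParity a b c d = crossParity a b d c := by
  unfold crossParity
  rw [rayParity_comm a c d, rayParity_comm b c d]
  ring

theorem crossParity_comm {a b c d : ℝ × ℝ} (hac : a.1 ≠ c.1) (had : a.1 ≠ d.1) (hbc : b.1 ≠ c.1)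
    (hbd : b.1 ≠ d.1) : crossParity a b c d = crossParity c d a b := by
  have h1 := leftParity_add_swap hac
  have h2 := leftParity_add_swap had
  have h3 := leftParity_add_swap hbc
  have h4 := leftParity_add_swap hbd
  have h5 := CharTwo.two_eq_zero (R := ZMod 2)
  unfold crossParity
  linear_combination h1 + h2 + h3 + h4 + (2 - leftParity c a - leftParity d a - leftParity c b
    - leftParity d b) * h5

theorem crossParity_self_left (a c d : ℝ × ℝ) : crossParity a a c d = 0 := by
  have h5 := CharTwo.two_eq_zero (R := ZMod 2)
  have h6 : ∀ p, rayParity p a a = 0 := fun p => by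
    simp only [rayParity, min_self, max_self, ite_eq_right_iff]
    rintro ⟨h, h', -⟩
    exact absurd h h'.not_gt
  unfold crossParity
  rw [h6, h6]
  linear_combination (rayParity a c d + leftParity a c + leftParity a d) * h5

/-- Disjoint segments keep their vertical order over the common range of abscissae. The left terms
record how the ranges lie: they sum to 1 when the ranges overlap partially, where exactly one of the
two relevant rays hits, and to 0 when the ranges are nested or apart, where the ray terms cancel or
vanish. -/
theorem crossParity_eq_zero_of_lt {a b c d : ℝ × ℝ} (hab : a.1 < b.1) (hcd : c.1 < d.1)
    (hac : a.1 < c.1) (hbc : b.1 ≠ c.1) (hbd : b.1 ≠ d.1)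
    (h : Disjoint (segment ℝ a b) (segment ℝ c d)) : crossParity a b c d = 0 := by
  have had := hac.trans hcd
  have hno := fun x y hx hy h1 h2 =>
    not_disjoint_segment_of_lineHeight (x := x) (y := y) hab hcd hx hy h1 h2 h
  have h5 : (1 + 1 : ZMod 2) = 0 := rfl
  rcases lt_or_gt_of_ne hbc with hbc | hbc
  · have hbd := hbc.trans hcd
    simp [crossParity, rayParity, leftParity, hab.le, hcd.le, hac, had, hbc, hbd, hac.not_gt,
      hbc.not_gt, hbd.not_gt, h5]
  rcases lt_or_gt_of_ne hbd with hbd | hbd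
  · have key : lineHeight a b c.1 < c.2 ↔ ¬ lineHeight c d b.1 < b.2 := by
      have m1 : c.1 ∈ Set.Icc a.1 b.1 ∩ Set.Icc c.1 d.1 :=
        ⟨⟨hac.le, hbc.le⟩, ⟨le_rfl, hcd.le⟩⟩
      have m2 : b.1 ∈ Set.Icc a.1 b.1 ∩ Set.Icc c.1 d.1 :=
        ⟨⟨hab.le, le_rfl⟩, ⟨hbc.le, hbd.le⟩⟩
      have e1 := hno c.1 b.1 m1 m2
      have e2 := hno b.1 c.1 m2 m1
      rw [lineHeight_left, lineHeight_right hab] at e1 e2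
      grind
    by_cases h0 : lineHeight c d b.1 < b.2 <;>
    simp [crossParity, rayParity, leftParity, hab.le, hcd.le, hac, had, hbc, hbd, hac.not_gt,
      hbc.not_gt, hbd.not_gt, key, h0] <;> decide
  · have key : lineHeight a b c.1 < c.2 ↔ lineHeight a b d.1 < d.2 := by
      have m1 : c.1 ∈ Set.Icc a.1 b.1 ∩ Set.Icc c.1 d.1 :=
        ⟨⟨hac.le, hbc.le⟩, ⟨le_rfl, hcd.le⟩⟩
      have m2 : d.1 ∈ Set.Icc a.1 b.1 ∩ Set.Icc c.1 d.1 :=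
        ⟨⟨had.le, hbd.le⟩, ⟨hcd.le, le_rfl⟩⟩
      have e1 := hno c.1 d.1 m1 m2
      have e2 := hno d.1 c.1 m2 m1
      rw [lineHeight_left, lineHeight_right hcd] at e1 e2
      grind
    by_cases h0 : lineHeight a b d.1 < d.2 <;>
    simp [crossParity, rayParity, leftParity, hab.le, hcd.le, hac, had, hbc, hbd, hac.not_gt,
      hbc.not_gt, hbd.not_gt, key, h0] <;> decide

/-- Degenerate segments are allowed because consecutive sample points on a curve may coincide;
otherwise symmetry reduces to `a` leftmost. -/
theorem crossParity_eq_zero {a b c d : ℝ × ℝ} (hab : a.1 = b.1 → a = b) (hcd : c.1 = d.1 → c = d)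
    (hac : a.1 ≠ c.1) (had : a.1 ≠ d.1) (hbc : b.1 ≠ c.1) (hbd : b.1 ≠ d.1)
    (h : Disjoint (segment ℝ a b) (segment ℝ c d)) : crossParity a b c d = 0 := by
  by_cases h1 : a.1 = b.1
  · rw [hab h1, crossParity_self_left]
  by_cases h2 : c.1 = d.1
  · rw [crossParity_comm hac had hbc hbd, hcd h2, crossParity_self_left]
  wlog h1' : a.1 < b.1 generalizing a b
  · rw [crossParity_swap_left]
    exact this (fun e => (hab e.symm).symm) hbc hbd hac had (segment_symm ℝ a b ▸ h) (Ne.symm h1)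
      (lt_of_le_of_ne (not_lt.1 h1') (Ne.symm h1))
  wlog h2' : c.1 < d.1 generalizing c d
  · rw [crossParity_swap_right]
    exact this (fun e => (hcd e.symm).symm) (Ne.symm h2) had hac hbd hbc (segment_symm ℝ c d ▸ h)
      (lt_of_le_of_ne (not_lt.1 h2') (Ne.symm h2))
  rcases lt_or_gt_of_ne hac with h3 | h3
  · exact crossParity_eq_zero_of_lt h1' h2' h3 hbc hbd h
  · rw [crossParity_comm hac had hbc hbd]
    exact crossParity_eq_zero_of_lt h2' h1' h3 had.symm hbd.symm h.symm

/-- Each pair of distinct points excludes at most one value of `t`, so finitely many values are bad.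
-/
theorem exists_shear_injOn {F : Set (ℝ × ℝ)} (hF : F.Finite) :
    ∃ t : ℝ, Set.InjOn (fun p : ℝ × ℝ => p.1 + t * p.2) F := by
  have hfin := (hF.prod hF).image fun x : (ℝ × ℝ) × (ℝ × ℝ) =>
    -(x.1.1 - x.2.1) / (x.1.2 - x.2.2)
  obtain ⟨t, -, ht⟩ := Set.infinite_univ.exists_notMem_finite hfin
  refine ⟨t, fun p hp q hq h => ?_⟩
  have h : p.1 + t * p.2 = q.1 + t * q.2 := h
  by_cases h2 : p.2 = q.2
  · ext
    · rw [h2] at h; linarith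
    · exact h2
  · refine absurd ⟨(p, q), ⟨hp, hq⟩, ?_⟩ ht
    have : p.2 - q.2 ≠ 0 := sub_ne_zero.2 h2
    simp only
    field_simp
    linarith

theorem sum_range_add_succ_of_charTwo {R : Type*} [CommRing R] [CharP R 2] (f : ℕ → R) (N : ℕ) :
    ∑ m ∈ Finset.range N, (f m + f (m + 1)) = f 0 + f N := by
  have h := Finset.sum_range_sub f N
  simp only [CharTwo.sub_eq_add] at h
  rw [add_comm (f 0), ← h]
  exact Finset.sum_congr rfl fun _ _ => add_comm _ _

/-- The parity of the number of crossings of the vertical ray below `p` with a polygonal chain. -/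
noncomputable def chainRayParity (N : ℕ) (p : ℝ × ℝ) (P : ℕ → ℝ × ℝ) : ZMod 2 :=
  ∑ m ∈ Finset.range N, rayParity p (P m) (P (m + 1))

/-- Every term is a sum of values at consecutive vertices of one chain, so the sum telescopes modulo
2 and only the ends of the chains survive. -/
theorem sum_crossParity (N : ℕ) (P Q : ℕ → ℝ × ℝ) :
    ∑ m ∈ Finset.range N, ∑ n ∈ Finset.range N, crossParity (P m) (P (m + 1)) (Q n) (Q (n + 1)) =
      chainRayParity N (P 0) Q + chainRayParity N (P N) Q + chainRayParity N (Q 0) P +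
        chainRayParity N (Q N) P + (leftParity (P 0) (Q 0) + leftParity (P N) (Q 0) +
          leftParity (P 0) (Q N) + leftParity (P N) (Q N)) := by
  have e1 : ∑ m ∈ Finset.range N, ∑ n ∈ Finset.range N, (rayParity (P m) (Q n) (Q (n + 1)) +
      rayParity (P (m + 1)) (Q n) (Q (n + 1))) =
        chainRayParity N (P 0) Q + chainRayParity N (P N) Q := by
    simp only [Finset.sum_add_distrib]
    rw [← sum_range_add_succ_of_charTwo (fun m => chainRayParity N (P m) Q), Finset.sum_add_distrib]
    rfl
  have e2 : ∑ m ∈ Finset.range N, ∑ n ∈ Finset.range N, (rayParity (Q n) (P m) (P (m + 1)) +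
      rayParity (Q (n + 1)) (P m) (P (m + 1))) =
        chainRayParity N (Q 0) P + chainRayParity N (Q N) P := by
    rw [Finset.sum_comm]
    simp only [Finset.sum_add_distrib]
    rw [← sum_range_add_succ_of_charTwo (fun m => chainRayParity N (Q m) P), Finset.sum_add_distrib]
    rfl
  have e3 : ∑ m ∈ Finset.range N, ∑ n ∈ Finset.range N, ((leftParity (P m) (Q n) +
      leftParity (P (m + 1)) (Q n)) + (leftParity (P m) (Q (n + 1)) +
        leftParity (P (m + 1)) (Q (n + 1)))) = (leftParity (P 0) (Q 0) + leftParity (P N) (Q 0)) +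
          (leftParity (P 0) (Q N) + leftParity (P N) (Q N)) := by
    rw [Finset.sum_comm]
    simp only [Finset.sum_add_distrib (s := Finset.range N) (f := fun m => leftParity (P m) (Q _) +
      leftParity (P (m + 1)) (Q _)),
      sum_range_add_succ_of_charTwo (fun m => leftParity (P m) (Q _))]
    rw [sum_range_add_succ_of_charTwo
      (fun n => leftParity (P 0) (Q n) + leftParity (P N) (Q n))]
  calc _ = _ := Finset.sum_congr rfl fun m _ => Finset.sum_congr rfl fun n _ =>
        show crossParity _ _ _ _ = (rayParity (P m) (Q n) (Q (n + 1)) +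
          rayParity (P (m + 1)) (Q n) (Q (n + 1))) + (rayParity (Q n) (P m) (P (m + 1)) +
      rayParity (Q (n + 1)) (P m) (P (m + 1))) + ((leftParity (P m) (Q n) +
      leftParity (P (m + 1)) (Q n)) + (leftParity (P m) (Q (n + 1)) +
        leftParity (P (m + 1)) (Q (n + 1)))) by unfold crossParity; ring
    _ = _ := by
      simp only [Finset.sum_add_distrib] at e1 e2 e3 ⊢
      rw [e1, e2, e3]
      ring

/-! ### No planar drawing of the complete graph on five vertices -/

/-- The parity obstruction to a planar drawing of the complete graph on five vertices: `R i k l`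
is the parity of crossings of the ray below `i` with the edge `k l`. -/
theorem completeGraph_five_parity (R : Fin 5 → Fin 5 → Fin 5 → ZMod 2) (L : Fin 5 → Fin 5 → ZMod 2)
    (hL : ∀ i j, i ≠ j → L i j + L j i = 1)
    (h : ∀ i j k l, i < j → k < l → i ≠ k → i ≠ l → j ≠ k → j ≠ l →
      R i k l + R j k l + R k i j + R l i j + (L i k + L j k + L i l + L j l) = 0) : False := by
  -- Add the three ways to split four vertices into two disjoint edges. The left terms cancel except
  -- for three pairs `L x y + L y x`, which contribute `3 = 1`.
  have key : ∀ i j k l, i < j → j < k → k < l →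
      (R i k l + R j k l + R k i j + R l i j) + (R i j l + R k j l + R j i k + R l i k) +
        (R i j k + R l j k + R j i l + R k i l) = 1 := by
    intro i j k l hij hjk hkl
    have hik := hij.trans hjk
    have hjl := hjk.trans hkl
    have hil := hij.trans hjl
    have h1 := h i j k l hij hkl hik.ne hil.ne hjk.ne hjl.ne
    have h2 := h i k j l hik hjl hij.ne hil.ne hjk.ne' hkl.ne
    have h3 := h i l j k hil hjk hij.ne hik.ne hjl.ne' hkl.ne'
    have e1 := hL j k hjk.ne
    have e2 := hL j l hjl.ne
    have e3 := hL k l hkl.ne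
    have h5 := CharTwo.two_eq_zero (R := ZMod 2)
    linear_combination h1 + h2 + h3 - e1 - e2 - e3 - (L i j + L i k + L i l + 2) * h5
  have k1 := key 0 1 2 3 (by decide) (by decide) (by decide)
  have k2 := key 0 1 2 4 (by decide) (by decide) (by decide)
  have k3 := key 0 1 3 4 (by decide) (by decide) (by decide)
  have k4 := key 0 2 3 4 (by decide) (by decide) (by decide)
  have k5 := key 1 2 3 4 (by decide) (by decide) (by decide)
  have h5 := CharTwo.two_eq_zero (R := ZMod 2)
  -- Each triple of vertices lies in exactly two of the five quadruples, so every `R` term occurs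
  -- twice and the five ones remain.
  have : (1 : ZMod 2) = 0 := by
    linear_combination -k1 - k2 - k3 - k4 - k5 + (R 0 1 2 + R 1 0 2 + R 2 0 1 + R 0 1 3 + 
      R 1 0 3 + R 3 0 1 + R 0 1 4 + R 1 0 4 + R 4 0 1 + R 0 2 3 + R 2 0 3 + R 3 0 2 + R 0 2 4 + 
      R 2 0 4 + R 4 0 2 + R 0 3 4 + R 3 0 4 + R 4 0 3 + R 1 2 3 + R 2 1 3 + R 3 1 2 + R 1 2 4 + 
      R 2 1 4 + R 4 1 2 + R 1 3 4 + R 3 1 4 + R 4 1 3 + R 2 3 4 + R 3 2 4 + R 4 2 3 - 2) * h5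
  exact absurd this (by decide)

open Filter

/-- Disjoint compact curves have a positive distance `ε`. For a fine subdivision, uniform continuity
keeps each segment within `ε / 2` of its first point, which lies on the curve. -/
theorem Path.eventually_disjoint_segment {E : Type*} [NormedAddCommGroup E] [NormedSpace ℝ E]
    {a b c d : E} (γ : Path a b) (γ' : Path c d)
    (h : Disjoint (Set.range γ) (Set.range γ')) :
    ∀ᶠ N : ℕ in atTop, ∀ m n : ℕ, Disjoint
      (segment ℝ (γ.extend (m / N)) (γ.extend ((m + 1 : ℕ) / N)))
      (segment ℝ (γ'.extend (n / N)) (γ'.extend ((n + 1 : ℕ) / N))) := by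
  obtain ⟨ε, hε, hdist⟩ : ∃ ε > 0, ∀ x ∈ Set.range γ, ∀ y ∈ Set.range γ', ε ≤ dist x y := by
    obtain ⟨ε, hε, hd⟩ := Metric.exists_pos_forall_lt_edist (isCompact_range γ.continuous)
      (isCompact_range γ'.continuous).isClosed h
    refine ⟨ε, hε, fun x hx y hy => ?_⟩
    have := hd x hx y hy
    rw [edist_nndist] at this
    exact_mod_cast this.le
  have huc : ∀ {a b : E} (γ : Path a b), UniformContinuous γ.extend := fun γ =>
    (CompactSpace.uniformContinuous_of_continuous γ.continuous).comp
      (LipschitzWith.projIcc zero_le_one).uniformContinuous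
  obtain ⟨δ, hδ, h1⟩ := Metric.uniformContinuous_iff.1 (huc γ) (ε / 2) (half_pos hε)
  obtain ⟨δ', hδ', h2⟩ := Metric.uniformContinuous_iff.1 (huc γ') (ε / 2) (half_pos hε)
  have hlim := tendsto_one_div_atTop_nhds_zero_nat (𝕜 := ℝ)
  filter_upwards [hlim.eventually_lt_const hδ, hlim.eventually_lt_const hδ'] with N hN hN' m n
  have hstep : ∀ m : ℕ, dist (((m + 1 : ℕ) : ℝ) / N) (m / N) = 1 / N := fun m => by
    rw [Real.dist_eq, ← sub_div]
    simp
  have hball : ∀ {x y : E}, dist y x < ε / 2 → segment ℝ x y ⊆ Metric.ball x (ε / 2) :=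
    fun hxy => (convex_ball _ _).segment_subset (Metric.mem_ball_self (half_pos hε)) hxy
  rw [Set.disjoint_left]
  intro z hz hz'
  have hz := hball (h1 ((hstep m).trans_lt hN)) hz
  have hz' := hball (h2 ((hstep n).trans_lt hN')) hz'
  have hrange : ∀ {a b : E} (γ : Path a b) (t : ℝ), γ.extend t ∈ Set.range γ :=
    fun γ t => γ.extend_range ▸ Set.mem_range_self t
  have := hdist _ (hrange γ (m / N)) _ (hrange γ' (n / N))
  have h3 := dist_triangle_left (γ.extend (m / N)) (γ'.extend (n / N)) z
  rw [Metric.mem_ball] at hz hz'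
  linarith

/-- The complete graph on five vertices cannot be drawn in the plane by paths so that edges
without a common end are disjoint. -/
theorem completeGraph_five_not_drawable (p : Fin 5 → ℝ × ℝ) (hp : Function.Injective p)
    (X : Fin 5 → Fin 5 → Set (ℝ × ℝ))
    (hJ : ∀ i j, i < j → JoinedIn (X i j) (p i) (p j))
    (hX : ∀ i j k l, i < j → k < l → i ≠ k → i ≠ l → j ≠ k → j ≠ l → Disjoint (X i j) (X k l)) :
    False := by
  choose γ hγ using hJ
  have hev : ∀ᶠ N : ℕ in atTop, ∀ i j k l, ∀ (hij : i < j) (hkl : k < l),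
      i ≠ k → i ≠ l → j ≠ k → j ≠ l → ∀ m n : ℕ, Disjoint
      (segment ℝ ((γ i j hij).extend (m / N)) ((γ i j hij).extend ((m + 1 : ℕ) / N)))
      (segment ℝ ((γ k l hkl).extend (n / N)) ((γ k l hkl).extend ((n + 1 : ℕ) / N))) := by
    simp only [eventually_all]
    intro i j k l hij hkl h1 h2 h3 h4
    refine Path.eventually_disjoint_segment _ _ ((hX i j k l hij hkl h1 h2 h3 h4).mono ?_ ?_)
    · exact Set.range_subset_iff.2 (hγ i j hij)
    · exact Set.range_subset_iff.2 (hγ k l hkl)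
  obtain ⟨N, hN, hN0⟩ := (hev.and (eventually_gt_atTop 0)).exists
  let q : Fin 5 → Fin 5 → ℕ → ℝ × ℝ := fun i j m =>
    if h : i < j then (γ i j h).extend (m / N) else p i
  have hq : ∀ {i j} (h : i < j) m, q i j m = (γ i j h).extend (m / N) := fun h m => dif_pos h
  have hfin : (⋃ i, ⋃ j, ⋃ m ∈ Set.Iic N, {q i j m}).Finite :=
    Set.finite_iUnion fun i => Set.finite_iUnion fun j =>
      (Set.finite_Iic N).biUnion fun m _ => Set.finite_singleton _
  obtain ⟨t, ht⟩ := exists_shear_injOn hfin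
  have hmem : ∀ i j m, m ≤ N → q i j m ∈ (⋃ i, ⋃ j, ⋃ m ∈ Set.Iic N, {q i j m}) := by
    intro i j m hm
    simp only [Set.mem_iUnion]
    exact ⟨i, j, m, hm, rfl⟩
  let σ : ℝ × ℝ →ₗ[ℝ] ℝ × ℝ :=
    (LinearMap.fst ℝ ℝ ℝ + t • LinearMap.snd ℝ ℝ ℝ).prod (LinearMap.snd ℝ ℝ ℝ)
  have hσ : Function.Injective σ := by
    intro x y hxy
    obtain ⟨h1, h2⟩ := Prod.ext_iff.1 hxy
    change x.1 + t * x.2 = y.1 + t * y.2 at h1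
    change x.2 = y.2 at h2
    ext
    · rw [h2] at h1; linarith
    · exact h2
  have hinj : ∀ {i j k l m n}, m ≤ N → n ≤ N → (σ (q i j m)).1 = (σ (q k l n)).1 →
      q i j m = q k l n := fun hm hn h => ht (hmem _ _ _ hm) (hmem _ _ _ hn) h
  have hN0' : (N : ℝ) ≠ 0 := by positivity
  have hq0 : ∀ {i j}, i < j → q i j 0 = p i := fun h => by simp [hq h]
  have hqN : ∀ {i j}, i < j → q i j N = p j := fun h => by simp [hq h, hN0']
  -- The default value of `q` puts every `p i` into the finite set, so the shear also gives the
  -- vertices distinct abscissae.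
  have hqi : ∀ i, q i i 0 = p i := fun i => dif_neg (lt_irrefl i)
  refine completeGraph_five_parity
    (fun i k l => chainRayParity N (σ (p i)) fun m => σ (q k l m))
    (fun i j => leftParity (σ (p i)) (σ (p j))) (fun i j hij => leftParity_add_swap ?_) ?_
  · intro h
    rw [← hqi i, ← hqi j] at h
    have := hinj (Nat.zero_le N) (Nat.zero_le N) h
    rw [hqi, hqi] at this
    exact hij (hp this)
  intro i j k l hij hkl hik hil hjk hjl
  have hsum := sum_crossParity N (fun m => σ (q i j m)) (fun n => σ (q k l n))
  rw [Finset.sum_eq_zero fun m hm => Finset.sum_eq_zero fun n hn => ?_] at hsum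
  · simp only [hq0, hqN, hij, hkl] at hsum
    rw [hsum]
  have hdis : ∀ m n, Disjoint (segment ℝ (q i j m) (q i j (m + 1)))
      (segment ℝ (q k l n) (q k l (n + 1))) := fun m n => by
    simpa only [hq hij, hq hkl] using hN i j k l hij hkl hik hil hjk hjl m n
  have hne : ∀ m n, q i j m ≠ q k l n := fun m n h =>
    Set.disjoint_left.1 (hdis m n) (left_mem_segment _ _ _) (h ▸ left_mem_segment _ _ _)
  have hm := Finset.mem_range.1 hm
  have hn := Finset.mem_range.1 hn
  refine crossParity_eq_zero (fun h => congrArg σ (hinj hm.le hm h))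
    (fun h => congrArg σ (hinj hn.le hn h)) (fun h => hne _ _ (hinj hm.le hn.le h))
    (fun h => hne _ _ (hinj hm.le hn h)) (fun h => hne _ _ (hinj hm hn.le h))
    (fun h => hne _ _ (hinj hm hn h)) ?_
  -- The shear is linear and injective: it maps segments to segments and preserves disjointness.
  have himg : ∀ a b, segment ℝ (σ a) (σ b) = σ '' segment ℝ a b := fun a b =>
    (image_segment ℝ σ.toAffineMap a b).symm
  rw [himg, himg]
  exact (Set.disjoint_image_iff hσ).2 (hdis m n)

/-! ### Planar graphs have no `K₅` minor -/

namespace HubCenter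

open SimpleGraph

variable {V : Type*} {G : SimpleGraph V}

/-- The part of the plane occupied by the subgraph induced by a set of vertices. -/
def PlaneEmbedding.carrier (E : PlaneEmbedding G) (B : Set V) : Set (ℝ × ℝ) :=
  E.point '' B ∪ ⋃ e : G.edgeSet, ⋃ _ : ∀ v ∈ (e : Sym2 V), v ∈ B, Set.range (E.curve e)

theorem PlaneEmbedding.exists_point_eq_of_end (E : PlaneEmbedding G) (e : G.edgeSet)
    {t : unitInterval} (ht : t = 0 ∨ t = 1) : ∃ v ∈ (e : Sym2 V), E.point v = E.curve e t := by
  have h : E.curve e t ∈ Sym2.map E.point (e : Sym2 V) := by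
    rw [← E.curve_ends e, Sym2.mem_iff]
    rcases ht with rfl | rfl
    · exact Or.inl rfl
    · exact Or.inr rfl
  exact Sym2.mem_map.1 h

theorem PlaneEmbedding.disjoint_carrier (E : PlaneEmbedding G) {B B' : Set V}
    (h : Disjoint B B') : Disjoint (E.carrier B) (E.carrier B') := by
  have hpc : ∀ {B B' : Set V}, Disjoint B B' → ∀ v ∈ B, ∀ e : G.edgeSet,
      (∀ u ∈ (e : Sym2 V), u ∈ B') → ∀ t, E.point v ≠ E.curve e t := by
    intro B B' h v hv e he t heq
    obtain ⟨u, hu, hut⟩ := E.exists_point_eq_of_end e (E.curve_avoids_vertices e t v heq.symm)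
    have := E.point_injective (hut.trans heq.symm)
    exact Set.disjoint_left.1 h hv (this ▸ he u hu)
  rw [Set.disjoint_left]
  rintro z hz hz'
  simp only [carrier, Set.mem_union, Set.mem_image, Set.mem_iUnion, Set.mem_range] at hz hz'
  rcases hz with ⟨v, hv, rfl⟩ | ⟨e, he, t, rfl⟩ <;> rcases hz' with ⟨u, hu, hz'⟩ | ⟨f, hf, s, hz'⟩
  · exact Set.disjoint_left.1 h hv (E.point_injective hz' ▸ hu)
  · exact hpc h v hv f hf s hz'.symm
  · exact hpc h.symm u hu e he t hz'
  · have hef : e ≠ f := by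
      rintro rfl
      obtain ⟨v, hv, -⟩ := E.exists_point_eq_of_end e (Or.inl rfl)
      exact Set.disjoint_left.1 h (he v hv) (hf v hv)
    obtain ⟨ht, hs⟩ := E.curves_disjoint e f hef t s hz'.symm
    obtain ⟨v, hv, hvt⟩ := E.exists_point_eq_of_end e ht
    exact hpc h v (he v hv) f hf s (hvt.trans hz'.symm)

theorem PlaneEmbedding.joinedIn_of_adj (E : PlaneEmbedding G) {B : Set V} {u v : V} (hu : u ∈ B)
    (hv : v ∈ B) (h : G.Adj u v) : JoinedIn (E.carrier B) (E.point u) (E.point v) := by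
  let e : G.edgeSet := ⟨s(u, v), h⟩
  have hsub : Set.range (E.curve e) ⊆ E.carrier B := by
    refine fun z hz => Or.inr (Set.mem_iUnion₂.2 ⟨e, ?_, hz⟩)
    intro w hw
    rcases Sym2.mem_iff.1 hw with rfl | rfl
    · exact hu
    · exact hv
  have hends : s(E.curve e 0, E.curve e 1) = s(E.point u, E.point v) := E.curve_ends e
  have hjoin : JoinedIn (E.carrier B) (E.curve e 0) (E.curve e 1) :=
    ⟨⟨⟨E.curve e, E.curve_continuous e⟩, rfl, rfl⟩, fun t => hsub ⟨t, rfl⟩⟩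
  rcases Sym2.eq_iff.1 hends with h | h
  · exact h.1 ▸ h.2 ▸ hjoin
  · exact h.1 ▸ h.2 ▸ hjoin.symm

theorem PlaneEmbedding.joinedIn_of_preconnected (E : PlaneEmbedding G) {B : Set V}
    (hB : (G.induce B).Preconnected) {u v : V} (hu : u ∈ B) (hv : v ∈ B) :
    JoinedIn (E.carrier B) (E.point u) (E.point v) := by
  obtain ⟨p⟩ := hB ⟨u, hu⟩ ⟨v, hv⟩
  suffices ∀ {x y : B} (p : (G.induce B).Walk x y),
    JoinedIn (E.carrier B) (E.point x) (E.point y) from this p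
  intro x y p
  induction p with
  | nil => exact JoinedIn.refl (Or.inl (Set.mem_image_of_mem _ (Subtype.prop _)))
  | cons h _ ih => exact (E.joinedIn_of_adj (Subtype.prop _) (Subtype.prop _) h).trans ih

/-- Choose one vertex in each branch set and draw the edge `i j` inside the carrier of `B i ∪ B j`.
Carriers of disjoint vertex sets are disjoint, so independent edges do not meet. -/
theorem IsPlanar.not_isMinor_completeGraph_five (h : IsPlanar G) :
    ¬ IsMinor (⊤ : SimpleGraph (Fin 5)) G := by
  rintro ⟨B, hconn, hdisj, hadj⟩
  obtain ⟨E⟩ := h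
  choose p hp using fun i => (Set.nonempty_coe_sort.1 (hconn i).nonempty)
  refine completeGraph_five_not_drawable (fun i => E.point (p i)) ?_
    (fun i j => E.carrier (B i ∪ B j)) ?_ ?_
  · refine E.point_injective.comp fun i j hij => ?_
    by_contra hne
    exact Set.disjoint_left.1 (hdisj i j hne) (hp i) (hij ▸ hp j)
  · intro i j hij
    obtain ⟨u, hu, v, hv, huv⟩ := hadj i j hij.ne
    exact E.joinedIn_of_preconnected (connected_induce_union (hconn i).preconnected
      (hconn j).preconnected hu hv huv).preconnected (Or.inl (hp i)) (Or.inr (hp j))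
  · intro i j k l _ _ hik hil hjk hjl
    refine E.disjoint_carrier ?_
    simp only [Set.disjoint_union_left, Set.disjoint_union_right]
    exact ⟨⟨hdisj _ _ hik, hdisj _ _ hjk⟩, hdisj _ _ hil, hdisj _ _ hjl⟩

end HubCenter

/-! ### Composition of minors, and `K₅` minors from long edges on a grid -/

namespace HubCenter

open SimpleGraph

/-- A graph whose vertices admit a descent to a root within a set `T` is connected on `T`. -/
theorem connected_induce_of_descent {W : Type*} {H : SimpleGraph W} {T : Set W} (root : W)
    (hroot : root ∈ T) (μ : W → ℕ)
    (h : ∀ q ∈ T, q ≠ root → ∃ q' ∈ T, H.Adj q q' ∧ μ q' < μ q) : (H.induce T).Connected := by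
  have key : ∀ n, ∀ q (hq : q ∈ T), μ q = n → (H.induce T).Reachable ⟨q, hq⟩ ⟨root, hroot⟩ := by
    intro n
    induction n using Nat.strong_induction_on with
    | _ n ih =>
      intro q hq hn
      by_cases hqr : q = root
      · subst hqr; exact Reachable.refl _
      · obtain ⟨q', hq', hadj, hlt⟩ := h q hq hqr
        have hadj' : (H.induce T).Adj ⟨q, hq⟩ ⟨q', hq'⟩ := hadj
        exact hadj'.reachable.trans (ih _ (hn ▸ hlt) q' hq' rfl)
  have : Nonempty T := ⟨⟨root, hroot⟩⟩
  exact ⟨fun u v => (key _ u u.2 rfl).trans (key _ v v.2 rfl).symm⟩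

theorem connected_induce_biUnion {W V : Type*} {H : SimpleGraph W} {G : SimpleGraph V}
    {B : W → Set V} (hB : ∀ w, (G.induce (B w)).Connected)
    (hadj : ∀ w w', H.Adj w w' → ∃ u ∈ B w, ∃ v ∈ B w', G.Adj u v) {T : Set W}
    (hT : (H.induce T).Connected) : (G.induce (⋃ w ∈ T, B w)).Connected := by
  have hsub : ∀ w ∈ T, B w ⊆ ⋃ w ∈ T, B w := fun w hw => Set.subset_biUnion_of_mem hw
  have hin : ∀ w (hw : w ∈ T), ∀ u v (hu : u ∈ B w) (hv : v ∈ B w),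
      (G.induce (⋃ w ∈ T, B w)).Reachable ⟨u, hsub w hw hu⟩ ⟨v, hsub w hw hv⟩ := by
    intro w hw u v hu hv
    exact ((hB w).preconnected ⟨u, hu⟩ ⟨v, hv⟩).map (induceHomOfLE G (hsub w hw)).toHom
  have hwalk : ∀ {w w' : T} (_ : (H.induce T).Walk w w'), ∀ u v (hu : u ∈ B w) (hv : v ∈ B w'),
      (G.induce (⋃ w ∈ T, B w)).Reachable ⟨u, hsub w w.2 hu⟩ ⟨v, hsub w' w'.2 hv⟩ := by
    intro w w' p
    induction p with
    | nil => exact fun u v hu hv => hin _ (Subtype.prop _) u v hu hv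
    | cons h _ ih =>
      intro u v hu hv
      obtain ⟨x, hx, y, hy, hxy⟩ := hadj _ _ h
      have hxy' : (G.induce (⋃ w ∈ T, B w)).Adj ⟨x, hsub _ (Subtype.prop _) hx⟩
        ⟨y, hsub _ (Subtype.prop _) hy⟩ := hxy
      exact ((hin _ (Subtype.prop _) u x hu hx).trans hxy'.reachable).trans (ih y v hy hv)
  obtain ⟨w₀⟩ := hT.nonempty
  obtain ⟨u₀⟩ := (hB w₀).nonempty
  have : Nonempty ↥(⋃ w ∈ T, B w) := ⟨⟨u₀, hsub _ w₀.2 u₀.2⟩⟩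
  refine ⟨fun u v => ?_⟩
  obtain ⟨w, hw, hu⟩ := Set.mem_iUnion₂.1 u.2
  obtain ⟨w', hw', hv⟩ := Set.mem_iUnion₂.1 v.2
  obtain ⟨p⟩ := hT.preconnected ⟨w, hw⟩ ⟨w', hw'⟩
  exact hwalk p u v hu hv

theorem IsMinor.trans {U W V : Type*} {F : SimpleGraph U} {H : SimpleGraph W} {G : SimpleGraph V}
    (hFH : IsMinor F H) (hHG : IsMinor H G) : IsMinor F G := by
  obtain ⟨T, hT, hTd, hTa⟩ := hFH
  obtain ⟨B, hB, hBd, hBa⟩ := hHG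
  refine ⟨fun i => ⋃ w ∈ T i, B w, fun i => connected_induce_biUnion hB hBa (hT i), ?_, ?_⟩
  · intro i j hij
    rw [Set.disjoint_left]
    intro v hv hv'
    obtain ⟨w, hw, hvw⟩ := Set.mem_iUnion₂.1 hv
    obtain ⟨w', hw', hvw'⟩ := Set.mem_iUnion₂.1 hv'
    by_cases h : w = w'
    · exact Set.disjoint_left.1 (hTd i j hij) hw (h ▸ hw')
    · exact Set.disjoint_left.1 (hBd w w' h) hvw hvw'
  · intro i j hij
    obtain ⟨w, hw, w', hw', hww⟩ := hTa i j hij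
    obtain ⟨u, hu, v, hv, huv⟩ := hBa w w' hww
    exact ⟨u, Set.mem_biUnion hw hu, v, Set.mem_biUnion hw' hv, huv⟩

theorem isMinor_of_iso {W V : Type*} {H : SimpleGraph W} {G : SimpleGraph V} (e : H ≃g G) :
    IsMinor H G := by
  refine ⟨fun w => {e w}, fun w => ?_, fun w w' h => ?_, fun w w' h => ?_⟩
  · have : Nonempty ({e w} : Set V) := ⟨⟨e w, rfl⟩⟩
    exact ⟨fun u v => Subsingleton.elim u v ▸ Reachable.refl _⟩
  · exact Set.disjoint_singleton.2 (e.injective.ne h)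
  · exact ⟨_, rfl, _, rfl, e.map_adj_iff.2 h⟩

variable {ρ : ℕ}

theorem grid_adj_iff {p q : Fin ρ × Fin ρ} : (grid ρ).Adj p q ↔
    ((p.1 : ℕ) = q.1 ∧ ((p.2 : ℕ) + 1 = q.2 ∨ (q.2 : ℕ) + 1 = p.2)) ∨
    ((p.2 : ℕ) = q.2 ∧ ((p.1 : ℕ) + 1 = q.1 ∨ (q.1 : ℕ) + 1 = p.1)) := by
  change |((p.1 : ℕ) : ℤ) - ((q.1 : ℕ) : ℤ)| + |((p.2 : ℕ) : ℤ) - ((q.2 : ℕ) : ℤ)| = 1 ↔ _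
  rcases abs_cases (((p.1 : ℕ) : ℤ) - ((q.1 : ℕ) : ℤ)) with h | h <;>
  rcases abs_cases (((p.2 : ℕ) : ℤ) - ((q.2 : ℕ) : ℤ)) with h' | h' <;>
  omega

/-- The two coordinates of `p` and `q` differ by at most `n`. -/
def Near (n : ℕ) (p q : Fin ρ × Fin ρ) : Prop :=
  (p.1 : ℕ) ≤ q.1 + n ∧ (q.1 : ℕ) ≤ p.1 + n ∧ (p.2 : ℕ) ≤ q.2 + n ∧ (q.2 : ℕ) ≤ p.2 + n

/-- A partition of the grid into the point `(a, b)`, three arcs of the ring around it and the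
points outside the ring. -/
def ringColour (a b x y : ℕ) : Fin 5 :=
  if x = a ∧ y = b then 0
  else if y + 1 = b ∧ a ≤ x + 1 ∧ x ≤ a + 1 then 1
  else if a ≤ x ∧ x ≤ a + 1 ∧ b ≤ y ∧ y ≤ b + 1 then 2
  else if x + 1 = a ∧ b ≤ y ∧ y ≤ b + 1 then 3
  else 4

theorem ringColour_eq_iff (a b x y : ℕ) :
    (ringColour a b x y = 0 ↔ x = a ∧ y = b) ∧
    (ringColour a b x y = 1 ↔ y + 1 = b ∧ a ≤ x + 1 ∧ x ≤ a + 1) ∧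
    (ringColour a b x y = 2 ↔ a ≤ x ∧ x ≤ a + 1 ∧ b ≤ y ∧ y ≤ b + 1 ∧ ¬ (x = a ∧ y = b)) ∧
    (ringColour a b x y = 3 ↔ x + 1 = a ∧ b ≤ y ∧ y ≤ b + 1) ∧
    (ringColour a b x y = 4 ↔ ¬ (a ≤ x + 1 ∧ x ≤ a + 1 ∧ b ≤ y + 1 ∧ y ≤ b + 1)) := by
  unfold ringColour
  refine ⟨?_, ?_, ?_, ?_, ?_⟩ <;> split_ifs <;> simp <;> omega

/-- The branch sets are the classes of `ringColour`. The grid supplies every adjacency except the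
one between the centre and the outside, which is the long edge. -/
theorem isMinor_completeGraph_five_of_adj_far {H : SimpleGraph (Fin ρ × Fin ρ)} (hH : grid ρ ≤ H)
    {c c' : Fin ρ × Fin ρ} (hadj : H.Adj c c') (h1 : 1 ≤ (c.1 : ℕ)) (h2 : 1 ≤ (c.2 : ℕ))
    (h3 : (c.1 : ℕ) + 2 < ρ) (h4 : (c.2 : ℕ) + 2 < ρ) (hfar : ¬ Near 1 c c') :
    IsMinor (⊤ : SimpleGraph (Fin 5)) H := by
  obtain ⟨⟨a, ha⟩, ⟨b, hb⟩⟩ := c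
  simp only at h1 h2 h3 h4
  let T : Fin 5 → Set (Fin ρ × Fin ρ) := fun i => {q | ringColour a b q.1 q.2 = i}
  have hgrid : ∀ {x y x' y' : ℕ} (hx : x < ρ) (hy : y < ρ) (hx' : x' < ρ) (hy' : y' < ρ),
      (x = x' ∧ (y + 1 = y' ∨ y' + 1 = y)) ∨ (y = y' ∧ (x + 1 = x' ∨ x' + 1 = x)) →
      H.Adj (⟨x, hx⟩, ⟨y, hy⟩) (⟨x', hx'⟩, ⟨y', hy'⟩) :=
    fun _ _ _ _ h => hH (grid_adj_iff.2 h)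
  -- Each class has a top right corner reachable from all its points by steps that increase a
  -- coordinate. For the outside class this needs a free column to the right of the square and a
  -- free row above it, hence `h3` and `h4`.
  have hconn : ∀ (i : Fin 5) (X Y : ℕ) (hX : X < ρ) (hY : Y < ρ), ringColour a b X Y = i →
      (∀ x y, x < ρ → y < ρ → ringColour a b x y = i → ¬ (x = X ∧ y = Y) →
        (x + 1 < ρ ∧ ringColour a b (x + 1) y = i) ∨ (y + 1 < ρ ∧ ringColour a b x (y + 1) = i)) →
      (H.induce (T i)).Connected := by
    intro i X Y hX hY hr hstep
    refine connected_induce_of_descent (⟨X, hX⟩, ⟨Y, hY⟩) hr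
      (fun q => (ρ - q.1) + (ρ - q.2)) ?_
    rintro ⟨⟨x, hx⟩, ⟨y, hy⟩⟩ hq hne
    rcases hstep x y hx hy hq (by simpa using hne) with ⟨h, h'⟩ | ⟨h, h'⟩
    · exact ⟨(⟨x + 1, h⟩, ⟨y, hy⟩), h', hgrid _ _ _ _ (by omega), by simp only; omega⟩
    · exact ⟨(⟨x, hx⟩, ⟨y + 1, h⟩), h', hgrid _ _ _ _ (by omega), by simp only; omega⟩
  have hR := ringColour_eq_iff a b
  refine ⟨T, ?_, ?_, ?_⟩
  · intro i
    fin_cases i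
    · refine hconn 0 a b ha hb ((hR _ _).1.2 (by omega)) fun x y _ _ h => ?_
      simp only [hR] at h ⊢; omega
    · refine hconn 1 (a + 1) (b - 1) (by omega) (by omega) ((hR _ _).2.1.2 (by omega))
        fun x y _ _ h => ?_
      simp only [hR] at h ⊢; omega
    · refine hconn 2 (a + 1) (b + 1) (by omega) (by omega) ((hR _ _).2.2.1.2 (by omega))
        fun x y _ _ h => ?_
      simp only [hR] at h ⊢; omega
    · refine hconn 3 (a - 1) (b + 1) (by omega) (by omega) ((hR _ _).2.2.2.1.2 (by omega))
        fun x y _ _ h => ?_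
      simp only [hR] at h ⊢; omega
    · refine hconn 4 (ρ - 1) (ρ - 1) (by omega) (by omega) ((hR _ _).2.2.2.2.2 (by omega))
        fun x y _ _ h => ?_
      simp only [hR] at h ⊢; omega
  · exact fun i j hij => Set.disjoint_left.2 fun q hi hj => hij (Eq.trans (Eq.symm hi) hj)
  · have hsymm : ∀ i j, (∃ u ∈ T i, ∃ v ∈ T j, H.Adj u v) → ∃ u ∈ T j, ∃ v ∈ T i, H.Adj u v :=
      fun i j ⟨u, hu, v, hv, h⟩ => ⟨v, hv, u, hu, h.symm⟩
    have hedge : ∀ (i j : Fin 5) (x y x' y' : ℕ) (hx : x < ρ) (hy : y < ρ) (hx' : x' < ρ)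
        (hy' : y' < ρ), (x = x' ∧ (y + 1 = y' ∨ y' + 1 = y)) ∨
          (y = y' ∧ (x + 1 = x' ∨ x' + 1 = x)) → ringColour a b x y = i →
        ringColour a b x' y' = j → ∃ u ∈ T i, ∃ v ∈ T j, H.Adj u v :=
      fun i j x y x' y' hx hy hx' hy' h hi hj => ⟨_, hi, _, hj, hgrid hx hy hx' hy' h⟩
    have h01 := hedge 0 1 a b a (b - 1) (by omega) (by omega) (by omega) (by omega) (by omega)
      (by rw [(hR _ _).1]; omega) (by rw [(hR _ _).2.1]; omega)
    have h02 := hedge 0 2 a b (a + 1) b (by omega) (by omega) (by omega) (by omega) (by omega)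
      (by rw [(hR _ _).1]; omega) (by rw [(hR _ _).2.2.1]; omega)
    have h03 := hedge 0 3 a b (a - 1) b (by omega) (by omega) (by omega) (by omega) (by omega)
      (by rw [(hR _ _).1]; omega) (by rw [(hR _ _).2.2.2.1]; omega)
    have h04 : ∃ u ∈ T 0, ∃ v ∈ T 4, H.Adj u v := by
      refine ⟨_, (hR _ _).1.2 ⟨rfl, rfl⟩, _, (hR _ _).2.2.2.2.2 fun h => hfar ?_, hadj⟩
      unfold Near
      simp only
      omega
    have h12 := hedge 1 2 (a + 1) (b - 1) (a + 1) b (by omega) (by omega) (by omega) (by omega)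
      (by omega) (by rw [(hR _ _).2.1]; omega) (by rw [(hR _ _).2.2.1]; omega)
    have h13 := hedge 1 3 (a - 1) (b - 1) (a - 1) b (by omega) (by omega) (by omega) (by omega)
      (by omega) (by rw [(hR _ _).2.1]; omega) (by rw [(hR _ _).2.2.2.1]; omega)
    have h14 := hedge 1 4 (a + 1) (b - 1) (a + 2) (b - 1) (by omega) (by omega) (by omega)
      (by omega) (by omega) (by rw [(hR _ _).2.1]; omega) (by rw [(hR _ _).2.2.2.2]; omega)
    have h23 := hedge 2 3 a (b + 1) (a - 1) (b + 1) (by omega) (by omega) (by omega) (by omega)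
      (by omega) (by rw [(hR _ _).2.2.1]; omega) (by rw [(hR _ _).2.2.2.1]; omega)
    have h24 := hedge 2 4 (a + 1) b (a + 2) b (by omega) (by omega) (by omega) (by omega)
      (by omega) (by rw [(hR _ _).2.2.1]; omega) (by rw [(hR _ _).2.2.2.2]; omega)
    have h34 := hedge 3 4 (a - 1) (b + 1) (a - 1) (b + 2) (by omega) (by omega) (by omega)
      (by omega) (by omega) (by rw [(hR _ _).2.2.2.1]; omega) (by rw [(hR _ _).2.2.2.2]; omega)
    intro i j hij
    wlog hlt : i < j generalizing i j
    · exact hsymm _ _ (this j i hij.symm (lt_of_le_of_ne (not_lt.1 hlt) hij.ne'))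
    fin_cases i <;> fin_cases j <;> first | assumption | exact absurd hlt (by decide)

/-- In a supergraph of the grid without a `K₅` minor, edges at interior points of the grid are
short. -/
theorem near_of_adj {H : SimpleGraph (Fin ρ × Fin ρ)} (hH : grid ρ ≤ H)
    (hK : ¬ IsMinor (⊤ : SimpleGraph (Fin 5)) H) {c c' : Fin ρ × Fin ρ} (hadj : H.Adj c c')
    (h1 : 1 ≤ (c.1 : ℕ)) (h2 : 1 ≤ (c.2 : ℕ)) (h3 : (c.1 : ℕ) + 1 < ρ) (h4 : (c.2 : ℕ) + 1 < ρ) :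
    Near 1 c c' := by
  -- The only interior point is then `(1, 1)`, and every point is near it.
  by_cases hsmall : ρ ≤ 3
  · unfold Near; omega
  -- Otherwise `c.1 = ρ - 2`. Reflecting the grid sends this to 1, and `ρ ≥ 4` gives the room.
  wlog h3' : (c.1 : ℕ) + 2 < ρ generalizing H c c'
  · let e : Fin ρ × Fin ρ ≃ Fin ρ × Fin ρ := Fin.revPerm.prodCongr (Equiv.refl _)
    have he : ∀ x, e (e x) = x := fun x => by ext <;> simp [e]
    have := this (H := H.comap e) (c := e c) (c' := e c') (fun p q hpq => hH ?_)
      (fun h => hK (h.trans (isMinor_of_iso (Iso.comap e H)))) (by rwa [comap_adj, he, he])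
      ?_ ?_ ?_ ?_ ?_
    · simp only [Near, e, Equiv.prodCongr_apply, Prod.map, Fin.revPerm_apply, Fin.val_rev,
        Equiv.refl_apply] at this ⊢
      omega
    · rw [grid_adj_iff] at hpq ⊢
      simp only [e, Equiv.prodCongr_apply, Prod.map, Fin.revPerm_apply, Fin.val_rev,
        Equiv.refl_apply]
      omega
    all_goals
      simp only [e, Equiv.prodCongr_apply, Prod.map, Fin.revPerm_apply, Fin.val_rev,
        Equiv.refl_apply]
      omega
  wlog h4' : (c.2 : ℕ) + 2 < ρ generalizing H c c'
  · let e : Fin ρ × Fin ρ ≃ Fin ρ × Fin ρ := (Equiv.refl _).prodCongr Fin.revPerm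
    have he : ∀ x, e (e x) = x := fun x => by ext <;> simp [e]
    have := this (H := H.comap e) (c := e c) (c' := e c') (fun p q hpq => hH ?_)
      (fun h => hK (h.trans (isMinor_of_iso (Iso.comap e H)))) (by rwa [comap_adj, he, he])
      ?_ ?_ ?_ ?_ ?_ ?_
    · simp only [Near, e, Equiv.prodCongr_apply, Prod.map, Fin.revPerm_apply, Fin.val_rev,
        Equiv.refl_apply] at this ⊢
      omega
    · rw [grid_adj_iff] at hpq ⊢
      simp only [e, Equiv.prodCongr_apply, Prod.map, Fin.revPerm_apply, Fin.val_rev,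
        Equiv.refl_apply]
      omega
    all_goals
      simp only [e, Equiv.prodCongr_apply, Prod.map, Fin.revPerm_apply, Fin.val_rev,
        Equiv.refl_apply]
      omega
  by_contra hfar
  exact hK (isMinor_completeGraph_five_of_adj_far hH hadj h1 h2 h3' h4' hfar)

end HubCenter

/-! ### Spanning models, displacement of walks, and counting -/

namespace HubCenter

open SimpleGraph

variable {ρ : ℕ}

/-- In a connected finite graph, a minor model of a nonempty graph extends to one whose branch
sets cover all the vertices. -/
theorem IsMinor.exists_spanning_model {W V : Type*} [Finite W] [Nonempty W] [Finite V]
    {F : SimpleGraph W} {G : SimpleGraph V} (hG : G.Connected) (h : IsMinor F G) :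
    ∃ f : V → W, (∀ w, (G.induce (f ⁻¹' {w})).Connected) ∧
      ∀ w w', F.Adj w w' → ∃ u v, f u = w ∧ f v = w' ∧ G.Adj u v := by
  let P : Set (W → Set V) := {B | (∀ w, (G.induce (B w)).Connected) ∧
    (∀ w w', w ≠ w' → Disjoint (B w) (B w')) ∧
    (∀ w w', F.Adj w w' → ∃ u ∈ B w, ∃ v ∈ B w', G.Adj u v)}
  -- In a maximal model nothing is uncovered: a walk to an uncovered vertex would leave the model
  -- along some edge, whose outer end could be added to a branch set.
  obtain ⟨B, ⟨hB, hBd, hBa⟩, hmax⟩ := (Set.toFinite P).exists_maximal h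
  have hcover : ∀ v, ∃ w, v ∈ B w := by
    by_contra! hv
    obtain ⟨v, hv⟩ := hv
    obtain ⟨w₀⟩ := ‹Nonempty W›
    obtain ⟨u₀, hu₀⟩ := Set.nonempty_coe_sort.1 (hB w₀).nonempty
    obtain ⟨p⟩ := hG.preconnected u₀ v
    obtain ⟨d, -, hd1, hd2⟩ := p.exists_boundary_dart (⋃ w, B w) (Set.mem_iUnion.2 ⟨w₀, hu₀⟩)
      (by simpa using hv)
    obtain ⟨w, hw⟩ := Set.mem_iUnion.1 hd1
    have hd2 : ∀ w, d.snd ∉ B w := fun w hw => hd2 (Set.mem_iUnion.2 ⟨w, hw⟩)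
    classical
    let B' := Function.update B w (B w ∪ {d.snd})
    have hle : B ≤ B' := by
      intro w'
      by_cases hw' : w' = w
      · subst hw'
        simp [B']
      · simp [B', hw']
    have hB' : B' ∈ P := by
      refine ⟨fun w' => ?_, fun w' w'' hne => ?_, fun w' w'' ha => ?_⟩
      · by_cases hw' : w' = w
        · subst hw'
          rw [show B' w' = B w' ∪ {d.snd} from Function.update_self ..]
          refine connected_induce_union (hB w').preconnected ?_ hw (Set.mem_singleton _) d.adj
          exact fun x y => Subsingleton.elim x y ▸ Reachable.refl _
        · rw [show B' w' = B w' from Function.update_of_ne hw' ..]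
          exact hB w'
      · have hdis : ∀ w', w' ≠ w → Disjoint (B w ∪ {d.snd}) (B w') := fun w' hw' =>
          Set.disjoint_union_left.2 ⟨hBd _ _ hw'.symm, Set.disjoint_singleton_left.2 (hd2 w')⟩
        by_cases hw' : w' = w
        · subst hw'
          simp only [B', Function.update_self, Function.update_of_ne hne.symm]
          exact hdis _ hne.symm
        · by_cases hw'' : w'' = w
          · subst hw''
            simp only [B', Function.update_self, Function.update_of_ne hw']
            exact (hdis _ hw').symm
          · simp only [B', Function.update_of_ne hw', Function.update_of_ne hw'']
            exact hBd _ _ hne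
      · obtain ⟨u, hu, v, hv, huv⟩ := hBa w' w'' ha
        exact ⟨u, hle _ hu, v, hle _ hv, huv⟩
    exact hd2 w (hmax hB' hle w (by simp [B']))
  choose f hf using hcover
  have hpre : ∀ w, f ⁻¹' {w} = B w := fun w => by
    ext v
    refine ⟨fun h => h ▸ hf v, fun h => ?_⟩
    by_contra hne
    exact Set.disjoint_left.1 (hBd _ _ hne) (hf v) h
  refine ⟨f, fun w => hpre w ▸ hB w, fun w w' hww => ?_⟩
  obtain ⟨u, hu, v, hv, huv⟩ := hBa w w' hww
  rw [← hpre] at hu hv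
  exact ⟨u, v, hu, hv, huv⟩

/-- A point of the grid with at least `n` layers of the grid around it. -/
def Deep (n : ℕ) (c : Fin ρ × Fin ρ) : Prop :=
  n ≤ (c.1 : ℕ) ∧ n ≤ (c.2 : ℕ) ∧ (c.1 : ℕ) + n < ρ ∧ (c.2 : ℕ) + n < ρ

/-- Edges between boundary points may be long, so depth is a budget: each step lowers it by at most
1. With `n ≤ a + b`, the edges can be peeled off from either end, always at an end of depth at least
1. -/
theorem near_of_walk {V : Type*} {G : SimpleGraph V} {f : V → Fin ρ × Fin ρ}
    (hf : ∀ u v, G.Adj u v → Deep 1 (f u) → Near 1 (f u) (f v)) (n : ℕ) :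
    ∀ (a b : ℕ) (u v : V) (p : G.Walk u v), p.length = n → n ≤ a + b → Deep a (f u) →
      Deep b (f v) → Near n (f u) (f v) := by
  induction n with
  | zero =>
    intro a b u v p hp _ _ _
    have := Walk.eq_of_length_eq_zero hp
    subst this
    simp [Near]
  | succ n ih =>
    intro a b u v p hp hn ha hb
    -- If `a = 0` then `b ≥ 1`, and the reversed walk is used.
    wlog ha0 : 1 ≤ a generalizing a b u v
    · have := this b a v u p.reverse (by simpa using hp) (by omega) hb ha (by omega)
      unfold Near at this ⊢
      omega
    cases p with
    | nil => simp at hp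
    | @cons _ x _ h p =>
      have h1 := hf u x h (by unfold Deep at ha ⊢; omega)
      have h2 := ih (a - 1) b x v p (by simpa using hp) (by omega)
        (by unfold Deep Near at *; omega) hb
      unfold Near at *
      omega

theorem card_le_of_pairwise_near {n : ℕ} (C : Finset (Fin ρ × Fin ρ))
    (h : ∀ c ∈ C, ∀ c' ∈ C, Near n c c') : C.card ≤ (n + 1) ^ 2 := by
  rcases C.eq_empty_or_nonempty with rfl | hne
  · simp
  obtain ⟨p, hp, hpmin⟩ := C.exists_min_image (fun c => (c.1 : ℕ)) hne
  obtain ⟨q, hq, hqmin⟩ := C.exists_min_image (fun c => (c.2 : ℕ)) hne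
  calc C.card ≤ (Finset.Icc (p.1 : ℕ) (p.1 + n) ×ˢ Finset.Icc (q.2 : ℕ) (q.2 + n)).card := by
        refine Finset.card_le_card_of_injOn (fun c => ((c.1 : ℕ), (c.2 : ℕ))) ?_ ?_
        · intro c hc
          have h1 := hpmin c hc
          have h2 := hqmin c hc
          have h3 := h c hc p hp
          have h4 := h c hc q hq
          unfold Near at h3 h4
          simp only [Finset.coe_product, Finset.coe_Icc, Set.mem_prod, Set.mem_Icc]
          omega
        · rintro ⟨a, b⟩ _ ⟨a', b'⟩ _ heq
          simp only [Prod.mk.injEq] at heq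
          exact Prod.ext (Fin.ext heq.1) (Fin.ext heq.2)
    _ = (n + 1) ^ 2 := by
        simp only [Finset.card_product, Nat.card_Icc]
        rw [sq]
        congr 1 <;> omega

open Classical in
theorem card_deep (ρ R : ℕ) :
    ({c | Deep R c} : Finset (Fin ρ × Fin ρ)).card = (ρ - 2 * R) ^ 2 := by
  rw [sq]
  have : ({c | Deep R c} : Finset (Fin ρ × Fin ρ)) =
      ({i | R ≤ (i : ℕ) ∧ (i : ℕ) + R < ρ} : Finset (Fin ρ)) ×ˢ
        ({i | R ≤ (i : ℕ) ∧ (i : ℕ) + R < ρ} : Finset (Fin ρ)) := by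
    ext c
    simp only [Finset.mem_filter, Finset.mem_univ, true_and, Finset.mem_product]
    unfold Deep
    tauto
  rw [this, Finset.card_product]
  have hcard : ({i | R ≤ (i : ℕ) ∧ (i : ℕ) + R < ρ} : Finset (Fin ρ)).card = ρ - 2 * R := by
    rw [← Finset.card_map Fin.valEmbedding]
    have : Finset.map Fin.valEmbedding ({i | R ≤ (i : ℕ) ∧ (i : ℕ) + R < ρ} : Finset (Fin ρ)) =
        Finset.Ico R (ρ - R) := by
      ext x
      simp only [Finset.mem_map, Finset.mem_filter, Finset.mem_univ, true_and,
        Fin.valEmbedding_apply, Finset.mem_Ico]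
      constructor
      · rintro ⟨i, hi, rfl⟩
        omega
      · exact fun hx => ⟨⟨x, by omega⟩, by simp only; omega, rfl⟩
    rw [this, Nat.card_Ico]
    omega
  rw [hcard]

/-- If balls of radius `R` around the points of `S` cover a connected planar graph with a
`(ρ × ρ)`-grid minor, then `(ρ - 2R)² ≤ |S| (2R + 1)²`. -/
theorem sq_sub_le_of_ball_cover {V : Type*} [Finite V] {G : SimpleGraph V} (hG : G.Connected)
    (hplanar : IsPlanar G) (hgrid : IsMinor (grid ρ) G) (S : Finset V) (R : ℕ)
    (hS : ∀ v, ∃ h ∈ S, G.dist v h ≤ R) : (ρ - 2 * R) ^ 2 ≤ S.card * (2 * R + 1) ^ 2 := by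
  -- Extending the model to all vertices needs a branch set to start from.
  rcases Nat.eq_zero_or_pos ρ with rfl | hρ
  · simp
  have : Nonempty (Fin ρ × Fin ρ) := ⟨(⟨0, hρ⟩, ⟨0, hρ⟩)⟩
  obtain ⟨f, hconn, hadj⟩ := hgrid.exists_spanning_model hG
  let H : SimpleGraph (Fin ρ × Fin ρ) :=
    { Adj := fun w w' => w ≠ w' ∧ ∃ u v, f u = w ∧ f v = w' ∧ G.Adj u v
      symm := ⟨fun _ _ ⟨hne, u, v, hu, hv, h⟩ => ⟨hne.symm, v, u, hv, hu, h.symm⟩⟩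
      loopless := ⟨fun _ h => h.1 rfl⟩ }
  have hHG : IsMinor H G := by
    refine ⟨fun w => f ⁻¹' {w}, hconn, fun w w' hne => ?_, ?_⟩
    · exact Set.disjoint_left.2 fun v hv hv' => hne (hv.symm.trans hv')
    · rintro w w' ⟨-, u, v, hu, hv, h⟩
      exact ⟨u, hu, v, hv, h⟩
  have hle : grid ρ ≤ H := fun w w' h => ⟨h.ne, hadj w w' h⟩
  have hK : ¬ IsMinor (⊤ : SimpleGraph (Fin 5)) H := fun h =>
    hplanar.not_isMinor_completeGraph_five (h.trans hHG)
  have hf : ∀ u v, G.Adj u v → Deep 1 (f u) → Near 1 (f u) (f v) := by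
    intro u v huv hd
    by_cases hne : f u = f v
    · rw [hne]; simp [Near]
    · exact near_of_adj hle hK (c := f u) (c' := f v) ⟨hne, u, v, rfl, rfl, huv⟩ hd.1 hd.2.1
        hd.2.2.1 hd.2.2.2
  classical
  let C : V → Finset (Fin ρ × Fin ρ) := fun h =>
    {c | Deep R c ∧ ∃ u, f u = c ∧ G.dist u h ≤ R}
  have hC : ∀ h, (C h).card ≤ (2 * R + 1) ^ 2 := by
    intro h
    refine card_le_of_pairwise_near _ fun c hc c' hc' => ?_
    obtain ⟨hd, u, rfl, hu⟩ := (Finset.mem_filter.1 hc).2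
    obtain ⟨hd', v, rfl, hv⟩ := (Finset.mem_filter.1 hc').2
    obtain ⟨p, hp⟩ := hG.exists_walk_length_eq_dist u v
    have htri := hG.dist_triangle (u := u) (v := h) (w := v)
    rw [G.dist_comm (u := h)] at htri
    -- Both ends have depth `R` and the walk through the centre bounds the distance by `2R`, exactly
    -- the available budget.
    have := near_of_walk hf _ R R u v p rfl (by omega) hd hd'
    unfold Near at this ⊢
    omega
  have hcov : ({c | Deep R c} : Finset (Fin ρ × Fin ρ)) ⊆ S.biUnion C := by
    intro c hc
    obtain ⟨u, hu⟩ := Set.nonempty_coe_sort.1 (hconn c).nonempty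
    obtain ⟨h, hh, hd⟩ := hS u
    exact Finset.mem_biUnion.2 ⟨h, hh, Finset.mem_filter.2
      ⟨Finset.mem_univ _, (Finset.mem_filter.1 hc).2, u, hu, hd⟩⟩
  rw [← card_deep]
  exact (Finset.card_le_card hcov).trans (Finset.card_biUnion_le_card_mul _ _ _ fun h _ => hC h)

/-- In a preprocessed positive instance every vertex is at distance at most `r` from a hub. -/
theorem Instance.exists_dist_le {V : Type*} (I : Instance V) {r : ℝ} {S : Finset V}
    (hS : I.IsSolution r S) (hpre : I.IsPreprocessed r) (v : V) :
    ∃ h ∈ S, (I.graph.dist v h : ℝ) ≤ r := by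
  obtain ⟨p, hp, hpv⟩ := hpre v
  obtain ⟨h, hh, hph⟩ := hS.2.2 p hp
  refine ⟨h, hh, ?_⟩
  have h1 := I.connected.dist_triangle (u := v) (v := p.1) (w := h)
  have h2 := I.connected.dist_triangle (u := v) (v := p.2) (w := h)
  rw [I.graph.dist_comm (u := v) (v := p.1)] at h1
  rw [I.graph.dist_comm (u := p.2) (v := h)] at h2
  -- Summing the triangle inequalities through both ends of the demand regroups the four distances
  -- into the two service costs.
  have h3 : ((2 * I.graph.dist v h : ℕ) : ℝ) ≤
      ((I.serviceCost p v + I.serviceCost p h : ℕ) : ℝ) := by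
    rw [Nat.cast_le]
    unfold Instance.serviceCost
    omega
  push_cast at h3
  linarith

end HubCenter

theorem mainTheorem7 {V : Type*} [Finite V] (I : HubCenter.Instance V)
    (hplanar : HubCenter.IsPlanar I.graph) (r : ℝ) (hr : 0 ≤ r)
    (hpos : I.IsPositive r) (hpre : I.IsPreprocessed r)
    (ρ : ℕ) (hgrid : HubCenter.IsMinor (HubCenter.grid ρ) I.graph) :
    (ρ : ℝ) ≤ Real.sqrt (I.k : ℝ) * (2 * r + 1) + 2 * r := by
  obtain ⟨S, hS⟩ := hpos
  have hcover : ∀ v, ∃ h ∈ S, I.graph.dist v h ≤ ⌊r⌋₊ := fun v => by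
    obtain ⟨h, hh, hd⟩ := I.exists_dist_le hS hpre v
    exact ⟨h, hh, Nat.le_floor hd⟩
  have hsq := HubCenter.sq_sub_le_of_ball_cover I.connected hplanar hgrid S _ hcover
  rw [hS.2.1] at hsq
  have hR : (⌊r⌋₊ : ℝ) ≤ r := Nat.floor_le hr
  -- Subtraction in `ℕ` is truncated, which only helps: an inequality suffices.
  have hsub : (ρ : ℝ) - 2 * ⌊r⌋₊ ≤ ((ρ - 2 * ⌊r⌋₊ : ℕ) : ℝ) := by
    have : ((ρ : ℕ) : ℝ) ≤ ((ρ - 2 * ⌊r⌋₊ + 2 * ⌊r⌋₊ : ℕ) : ℝ) := Nat.cast_le.2 (by omega)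
    push_cast at this
    linarith
  have hroot : ((ρ - 2 * ⌊r⌋₊ : ℕ) : ℝ) ≤ Real.sqrt I.k * (2 * ⌊r⌋₊ + 1) := by
    refine (pow_le_pow_iff_left₀ (by positivity) (by positivity) two_ne_zero).1 ?_
    rw [mul_pow, Real.sq_sqrt (Nat.cast_nonneg _)]
    exact_mod_cast hsq
  have hmono : Real.sqrt I.k * (2 * ⌊r⌋₊ + 1) ≤ Real.sqrt I.k * (2 * r + 1) := by
    gcongr
  linarith
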